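/- For $x\in\mathbb{R}^d$ let $x^{\downarrow}=(x^{\downarrow}_1\ge\dots\ge x^{\downarrow}_d)$ denote the vector of the components of $x$ in decreasing order. For $x,y\in\mathbb{R}^d$, $x$ is majorized by $y$, written $x\prec y$, if $\sum_{j=1}^k x^{\downarrow}_j\le\sum_{j=1}^k y^{\downarrow}_j$ for $1\le k\le d$, with equality for $k=d$. For $x,y$ with non-negative components, $x$ is trumped by $y$, written $x\prec_T y$, if there are $n\ge 1$ and a vector $c\in\mathbb{R}^n$ with positive components such that $x\otimes c\prec y\otimes c$, where $x\otimes c\in\mathbb{R}^{dn}$ is the vector with components $x_ic_j$. A general Dirichlet polynomial is a function of the form $\sum_{n=1}^k a_ne^{-\lambda_n s}$ with $a_n\in\mathbb{R}$ and $0<\lambda_1<\dots<\lambda_k$. **Proposition.** Let $x$ and $y$ be vectors of the same length $d$, all of whose entries lie in $(1,\infty)$, with $x^{\downarrow}\ne y^{\downarrow}$, and let $$\zeta(s)=\sum_{i=1}^d\frac1{y_i^{s}}-\sum_{i=1}^d\frac1{x_i^{s}}\qquad(s\in\mathbb{R}).$$ Then the following statements are equivalent: 1. $x\prec_T y$; 2.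 $\zeta$ is a general Dirichlet polynomial with simple zeros at $-1$ and $0$ such that $\dfrac{\zeta(s)}{s(s+1)}$, extended continuously to $s=0$ and $s=-1$, is positive for all $s\in\mathbb{R}$. -/

import Mathlib

/-- `x↓`: the components of the finite real vector `x`, with multiplicity, listed in decreasing
order. -/
noncomputable def decreasingRearrangement {ι : Type*} [Fintype ι] (x : ι → ℝ) : List ℝ :=
  (Finset.univ.val.map x).sort (· ≥ ·)

/-- `x ≺ y`: the sum of the `k` largest components of `x` is at most that of `y` for all
`1 ≤ k ≤ d`, with equality for `k = d`, where `d` is the common length. -/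
def MajorizedBy {ι : Type*} [Fintype ι] (x y : ι → ℝ) : Prop :=
  (∀ k : ℕ, 1 ≤ k → k ≤ Fintype.card ι →
    ((decreasingRearrangement x).take k).sum ≤ ((decreasingRearrangement y).take k).sum) ∧
  ((decreasingRearrangement x).take (Fintype.card ι)).sum =
    ((decreasingRearrangement y).take (Fintype.card ι)).sum

/-- The tensor product `x ⊗ c` of two vectors: its components are all the products `x i * c j`. -/
def vecTensor {ι κ : Type*} (x : ι → ℝ) (c : κ → ℝ) : ι × κ → ℝ :=
  fun p => x p.1 * c p.2

/-- `x ≺_T y`: there is a catalyst, that is a vector `c` of some length `n ≥ 1` with positive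
components such that `x ⊗ c ≺ y ⊗ c`. -/
def TrumpedBy {d : ℕ} (x y : Fin d → ℝ) : Prop :=
  ∃ n : ℕ, 1 ≤ n ∧ ∃ c : Fin n → ℝ, (∀ j, 0 < c j) ∧
    MajorizedBy (vecTensor x c) (vecTensor y c)

/-- `ζ(s) = ∑ i, 1 / y i ^ s - ∑ i, 1 / x i ^ s`. -/
noncomputable def pairZeta {d : ℕ} (x y : Fin d → ℝ) (s : ℝ) : ℝ :=
  ∑ i, 1 / y i ^ s - ∑ i, 1 / x i ^ s

/-- General (real) Dirichlet polynomials: finite sums `∑ n, a n * exp (-(l n) * s)` with real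
coefficients and strictly increasing positive exponents. -/
def IsGeneralDirichletPolynomial (f : ℝ → ℝ) : Prop :=
  ∃ (k : ℕ) (a l : Fin k → ℝ), StrictMono l ∧ (∀ n, 0 < l n) ∧
    ∀ s : ℝ, f s = ∑ n, a n * Real.exp (-(l n) * s)

/-- `f` has a simple zero at `a`: it is analytic at `a` and vanishes there to order exactly one. -/
def HasSimpleZeroAt (f : ℝ → ℝ) (a : ℝ) : Prop :=
  analyticOrderAt f a = 1

/-- `f(s) / (s (s + 1))` is positive for all real `s`: the quotient extends continuously over the
(removable) singularities `0` and `-1`, and the extension is positive on the whole of `ℝ`. -/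
def QuotientPositiveOnReals (f : ℝ → ℝ) : Prop :=
  ∃ g : ℝ → ℝ, Continuous g ∧
    (∀ s : ℝ, s ≠ 0 → s ≠ -1 → g s = f s / (s * (s + 1))) ∧
    ∀ s : ℝ, 0 < g s

/-!
Majorization is tested by hinge functions: `x ≺ y` if and only if the sums agree and
`∑ i, max (x i - t) 0 ≤ ∑ i, max (y i - t) 0` for all `t` (`majorizedBy_iff_sum_hinge_le`). Let `w v`
be the multiplicity of `v` in `y` minus that in `x`. In the coordinate `t = exp u`, and divided by
`t`, the difference of the two hinge sums is the function `G u = ∑ v, w v * max (v * exp (-u) - 1) 0`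
(`logHinge`). Tensoring with a catalyst `c` replaces `G` by the sum of its translates by the numbers
`log (c j)`, so `x ≺_T y` means that, besides the equality of the sums, some finite sum of translates
of `G` is nonnegative (`trumpedBy_iff_exists_sum_logHinge_nonneg`).

When the sums agree, `G` has compact support, and integration gives
`p * (p - 1) * ∫ G u * exp (p * u) = ∑ v, w v * v ^ p` (`mul_integral_logHinge_mul_exp`). The right
side is `ζ(-p)`, so `ζ(s) / (s * (s + 1))` extended continuously is the Laplace transform of `G` at
`-s`. It remains to see that `G` has a nonnegative finite sum of translates if and only if its Laplace
transform is positive on the real line (`exists_sum_logHinge_nonneg_iff`).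

One direction holds because the Laplace transform turns a sum of translates into a product with a
positive factor. For the other, asymptotics of the power sums show that `G` is positive near both
ends of its support. Sampling `G` along a fine arithmetic progression, with nodes `u₀ + j * h`, gives
polynomials `∑ j, G (u₀ + j * h) * X ^ j` that are positive for all `X > 0`
(`exists_forall_sum_sample_exp_pos`): these values are, up to scaling, Riemann sums of the Laplace
transform, except for very large or very small `X`, where the samples near one end dominate. By
Pólya's theorem, applied uniformly in the offset `u₀`
(`exists_forall_sum_descFactorial_nonneg`), multiplication by a power `(1 + X) ^ N` makes all
coefficients nonnegative. Hence the translates of `G` by `k * h` with multiplicity `N.choose k`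
have a nonnegative sum (`exists_forall_sum_choose_mul_nonneg`), and the `N`-fold tensor power of
`(1, exp h)` is a catalyst.
-/

/-! ### Majorization through hinge functions -/

lemma List.take_sum_sub_le_sum_hinge (l : List ℝ) (t : ℝ) (k : ℕ) (hk : k ≤ l.length) :
    (l.take k).sum - k * t ≤ (l.map fun v => max (v - t) 0).sum := by
  induction l generalizing k with
  | nil => simp at hk; simp [hk]
  | cons v l ih =>
    cases k with
    | zero =>
      simp only [List.take_zero, List.sum_nil, Nat.cast_zero, zero_mul, sub_zero]
      exact List.sum_nonneg (by simp)
    | succ k =>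
      have h1 := ih k (by simpa using hk)
      have h2 : v - t ≤ max (v - t) 0 := le_max_left _ _
      simp only [List.take_succ_cons, List.sum_cons, List.map_cons]
      push_cast
      linarith

lemma List.sum_hinge_eq_zero {l : List ℝ} {t : ℝ} (h : ∀ v ∈ l, v ≤ t) :
    (l.map fun v => max (v - t) 0).sum = 0 := by
  apply List.sum_eq_zero
  intro a ha
  obtain ⟨v, hv, rfl⟩ := List.mem_map.1 ha
  exact max_eq_right (by linarith [h v hv])

/-- For a decreasing list the hinge sum at `t` is attained by one of the partial sums. -/
lemma List.exists_take_sum_eq_sum_hinge {l : List ℝ} (hl : l.Pairwise (· ≥ ·)) (t : ℝ) :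
    ∃ k ≤ l.length, (l.map fun v => max (v - t) 0).sum = (l.take k).sum - k * t := by
  induction l with
  | nil => exact ⟨0, by simp, by simp⟩
  | cons v l ih =>
    rw [List.pairwise_cons] at hl
    rcases le_or_gt v t with hv | hv
    · refine ⟨0, by simp, ?_⟩
      rw [List.sum_hinge_eq_zero]
      · simp
      · intro w hw
        rcases List.mem_cons.1 hw with rfl | hw
        · exact hv
        · exact (hl.1 w hw).trans hv
    · obtain ⟨k, hk, h⟩ := ih hl.2
      refine ⟨k + 1, by simpa using hk, ?_⟩
      simp only [List.take_succ_cons, List.sum_cons, List.map_cons, h,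
        max_eq_left (sub_nonneg.2 hv.le)]
      push_cast
      ring

/-- For a decreasing list each partial sum is attained by the hinge sum at some threshold, namely
at the last entry of the partial sum. -/
lemma List.exists_sum_hinge_eq_take_sum {l : List ℝ} (hl : l.Pairwise (· ≥ ·)) {k : ℕ}
    (hk1 : 1 ≤ k) (hk : k ≤ l.length) :
    ∃ t ∈ l, (l.map fun v => max (v - t) 0).sum = (l.take k).sum - k * t := by
  induction l generalizing k with
  | nil => simp at hk; omega
  | cons v l ih =>
    rw [List.pairwise_cons] at hl
    obtain ⟨k, rfl⟩ : ∃ k', k = k' + 1 := ⟨k - 1, by omega⟩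
    rcases Nat.eq_zero_or_pos k with rfl | hk0
    · refine ⟨v, by simp, ?_⟩
      rw [List.sum_hinge_eq_zero]
      · simp
      · intro w hw
        rcases List.mem_cons.1 hw with rfl | hw
        · exact le_rfl
        · exact hl.1 w hw
    · obtain ⟨t, ht, h⟩ := ih hl.2 hk0 (by simpa using hk)
      refine ⟨t, by simp [ht], ?_⟩
      simp only [List.take_succ_cons, List.sum_cons, List.map_cons, h,
        max_eq_left (sub_nonneg.2 (hl.1 t ht))]
      push_cast
      ring

lemma length_decreasingRearrangement {ι : Type*} [Fintype ι] (x : ι → ℝ) :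
    (decreasingRearrangement x).length = Fintype.card ι := by
  simp [decreasingRearrangement]

lemma sum_map_decreasingRearrangement {ι : Type*} [Fintype ι] (x : ι → ℝ) (f : ℝ → ℝ) :
    ((decreasingRearrangement x).map f).sum = ∑ i, f (x i) := by
  rw [← Multiset.sum_coe, ← Multiset.map_coe, decreasingRearrangement, Multiset.sort_eq,
    Multiset.map_map]
  rfl

lemma pairwise_decreasingRearrangement {ι : Type*} [Fintype ι] (x : ι → ℝ) :
    (decreasingRearrangement x).Pairwise (· ≥ ·) :=
  Multiset.pairwise_sort _ _

/-- The Hardy–Littlewood–Pólya description of majorization by the hinge functions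
`v ↦ max (v - t) 0`. -/
theorem majorizedBy_iff_sum_hinge_le {ι : Type*} [Fintype ι] (x y : ι → ℝ) :
    MajorizedBy x y ↔
      ∑ i, x i = ∑ i, y i ∧ ∀ t : ℝ, ∑ i, max (x i - t) 0 ≤ ∑ i, max (y i - t) 0 := by
  have hsum : ∀ z : ι → ℝ,
      ((decreasingRearrangement z).take (Fintype.card ι)).sum = ∑ i, z i := by
    intro z
    rw [List.take_of_length_le (length_decreasingRearrangement z).le]
    simpa using sum_map_decreasingRearrangement z id
  rw [MajorizedBy, hsum, hsum, and_comm]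
  refine and_congr_right fun _ => ⟨fun h t => ?_, fun h k hk1 hk => ?_⟩
  · obtain ⟨k, hk, hkt⟩ :=
      List.exists_take_sum_eq_sum_hinge (pairwise_decreasingRearrangement x) t
    have h2 := List.take_sum_sub_le_sum_hinge (decreasingRearrangement y) t k
      (by rwa [length_decreasingRearrangement] at hk ⊢)
    rw [sum_map_decreasingRearrangement] at hkt h2
    rw [length_decreasingRearrangement] at hk
    rcases Nat.eq_zero_or_pos k with rfl | hk0
    · simp only [List.take_zero, List.sum_nil, Nat.cast_zero, zero_mul, sub_zero] at hkt h2
      linarith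
    · linarith [h k hk0 hk]
  · obtain ⟨t, -, ht⟩ := List.exists_sum_hinge_eq_take_sum (pairwise_decreasingRearrangement y) hk1
      (by rwa [length_decreasingRearrangement])
    have h2 := List.take_sum_sub_le_sum_hinge (decreasingRearrangement x) t k
      (by rwa [length_decreasingRearrangement])
    rw [sum_map_decreasingRearrangement] at ht h2
    linarith [h t]

/-! ### Pólya's positivity theorem, uniformly in a parameter -/

open Filter Topology in
/-- Pólya's theorem in one variable for a family of polynomials `∑ j ≤ D, p s j * X ^ j` depending
continuously on a parameter `s` in a compact set. Up to a positive factor the coefficient of `X ^ m`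
in the product with `(1 + X) ^ N` is the sum below with `m + n = N + D`. After division by
`(N + D) ^ D` it is the value at `ε = 1 / (N + D)` of a function that is continuous in `s`,
`m / (N + D)` and `ε`, and positive at `ε = 0`. -/
theorem exists_forall_sum_descFactorial_nonneg {K : Set ℝ} (hK : IsCompact K) (D : ℕ)
    (p : ℝ → ℕ → ℝ) (hp : ∀ j, Continuous fun s => p s j)
    (h0 : ∀ s ∈ K, 0 < p s 0) (hD : ∀ s ∈ K, 0 < p s D)
    (hpos : ∀ s ∈ K, ∀ X : ℝ, 0 < X → 0 < ∑ j ∈ Finset.range (D + 1), p s j * X ^ j) :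
    ∃ N : ℕ, ∀ s ∈ K, ∀ m n : ℕ, m + n = N + D →
      0 ≤ ∑ j ∈ Finset.range (D + 1),
        p s j * ((m.descFactorial j : ℝ) * (n.descFactorial (D - j) : ℝ)) := by
  set Φ : (ℝ × ℝ) × ℝ → ℝ := fun z => ∑ j ∈ Finset.range (D + 1),
    p z.1.1 j * ((∏ i ∈ Finset.range j, (z.1.2 - i * z.2)) *
      ∏ i ∈ Finset.range (D - j), (1 - z.1.2 - i * z.2)) with hΦ
  have hΦc : Continuous Φ := by
    refine continuous_finsetSum _ fun j _ => ?_
    have := (hp j).comp (continuous_fst.comp (continuous_fst (X := ℝ × ℝ) (Y := ℝ)))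
    refine Continuous.mul this ?_
    fun_prop
  have hΦ0 : ∀ z ∈ K ×ˢ Set.Icc (0 : ℝ) 1, 0 < Φ (z, 0) := by
    rintro ⟨s, x⟩ ⟨hs, hx0, hx1⟩
    simp only at hs hx0 hx1
    have e : Φ ((s, x), 0) = ∑ j ∈ Finset.range (D + 1), p s j * (x ^ j * (1 - x) ^ (D - j)) := by
      simp [hΦ]
    rw [e]
    rcases hx0.eq_or_lt with rfl | hx0
    · rw [Finset.sum_eq_single 0]
      · simpa using h0 s hs
      · intro j _ hj; simp [hj]
      · simp
    rcases hx1.eq_or_lt with rfl | hx1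
    · rw [Finset.sum_eq_single D]
      · simpa using hD s hs
      · intro j hj hjD
        have : D - j ≠ 0 := by
          have := Finset.mem_range.1 hj
          omega
        simp [this]
      · simp
    · have h1x : 0 < 1 - x := by linarith
      have := mul_pos (pow_pos h1x D) (hpos s hs (x / (1 - x)) (by positivity))
      rw [Finset.mul_sum] at this
      refine this.trans_eq (Finset.sum_congr rfl fun j hj => ?_)
      have hj : j ≤ D := by
        have := Finset.mem_range.1 hj
        omega
      have hd : (1 - x) ^ D = (1 - x) ^ (D - j) * (1 - x) ^ j := by
        rw [← pow_add, Nat.sub_add_cancel hj]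
      rw [hd, div_pow]
      field_simp
  have hev : ∀ᶠ ε in 𝓝 (0 : ℝ), ∀ z ∈ K ×ˢ Set.Icc (0 : ℝ) 1, 0 < Φ (z, ε) := by
    refine (hK.prod isCompact_Icc).eventually_forall_of_forall_eventually fun z hz => ?_
    have hc : Continuous fun w : ℝ × (ℝ × ℝ) => Φ (w.2, w.1) := hΦc.comp continuous_swap
    exact hc.continuousAt.eventually (lt_mem_nhds (hΦ0 z hz))
  have hlim : Tendsto (fun N : ℕ => (1 : ℝ) / ((N : ℝ) + 1)) atTop (𝓝 0) :=
    tendsto_one_div_add_atTop_nhds_zero_nat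
  obtain ⟨N, hN⟩ := (hlim.eventually hev).exists_forall_of_atTop
  refine ⟨N + 1, fun s hs m n hmn => ?_⟩
  -- `M` is the common denominator `N + 1 + D`.
  set M : ℝ := ((N + D : ℕ) : ℝ) + 1 with hM
  have hMpos : 0 < M := by positivity
  have hmnR : (m : ℝ) + n = M := by
    rw [hM]; push_cast; have : ((m + n : ℕ) : ℝ) = ((N + 1 + D : ℕ) : ℝ) := by rw [hmn]
    push_cast at this; linarith
  have hdesc : ∀ a j : ℕ, (a.descFactorial j : ℝ) =
      M ^ j * ∏ i ∈ Finset.range j, ((a : ℝ) / M - i * (1 / M)) := by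
    intro a j
    induction j with
    | zero => simp
    | succ j ih =>
      rw [Nat.descFactorial_succ, Finset.prod_range_succ, pow_succ]
      have : ((a - j : ℕ) : ℝ) * (a.descFactorial j : ℝ) =
          ((a : ℝ) - j) * (a.descFactorial j : ℝ) := by
        rcases le_or_gt j a with h | h
        · rw [Nat.cast_sub h]
        · rw [Nat.descFactorial_of_lt h]; simp
      rw [Nat.cast_mul, this, ih]
      field_simp
  have key := hN (N + D) (by omega) (s, (m : ℝ) / M)
    ⟨hs, by positivity, by
      rw [div_le_one hMpos]; have : (0 : ℝ) ≤ n := by positivity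
      linarith⟩
  have hval : (1 : ℝ) - m / M = n / M := by
    field_simp; linarith
  have : ∑ j ∈ Finset.range (D + 1),
      p s j * ((m.descFactorial j : ℝ) * (n.descFactorial (D - j) : ℝ)) =
      M ^ D * Φ ((s, (m : ℝ) / M), 1 / M) := by
    rw [hΦ, Finset.mul_sum]
    refine Finset.sum_congr rfl fun j hj => ?_
    have hj : j ≤ D := by
      have := Finset.mem_range.1 hj
      omega
    simp only [hval]
    rw [hdesc, hdesc, ← Nat.sub_add_cancel hj, pow_add, Nat.add_sub_cancel]
    ring
  rw [this]
  exact (mul_pos (pow_pos hMpos D) key).le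

/-- The binomial coefficients as multiples of products of falling factorials; both sides vanish
when `m - j` is not in the range `0, …, N`. -/
lemma choose_mul_factorial_mul_factorial_eq {N D m n j : ℕ} (hj : j ≤ D) (hmn : m + n = N + D) :
    (if j ≤ m then (N.choose (m - j) : ℝ) else 0) * (m.factorial * n.factorial) =
      N.factorial * ((m.descFactorial j : ℝ) * (n.descFactorial (D - j) : ℝ)) := by
  rcases lt_or_ge m j with h | h
  · simp [Nat.descFactorial_of_lt h, h]
  rw [if_pos h]
  rcases lt_or_ge N (m - j) with h' | h'
  · rw [Nat.choose_eq_zero_of_lt h', Nat.descFactorial_of_lt (show n < D - j by omega)]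
    simp
  · have h1 := Nat.choose_mul_factorial_mul_factorial h'
    have h2 := Nat.factorial_mul_descFactorial h
    have h3 := Nat.factorial_mul_descFactorial (show D - j ≤ n by omega)
    have h4 : n - (D - j) = N - (m - j) := by omega
    rw [h4] at h3
    rw [← h1, ← h2, ← h3]
    push_cast
    ring

/-! ### Riemann sums and truncation -/

open Filter Topology in
/-- If the integrals over `[α, β]` of a continuous family over a compact parameter set are
positive, then so are all sufficiently fine Riemann sums whose nodes form an arithmetic progression,
simultaneously for all parameters and all positions of the nodes. -/
theorem eventually_forall_riemannSum_pos {F : ℝ → ℝ → ℝ} (hF : Continuous (Function.uncurry F))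
    {K : Set ℝ} (hK : IsCompact K) {α β : ℝ} (hαβ : α < β)
    (hpos : ∀ θ ∈ K, 0 < ∫ u in α..β, F θ u) :
    ∀ᶠ D : ℕ in atTop, ∀ θ ∈ K, ∀ u₀ ∈ Set.Icc α (α + (β - α) / ((D : ℝ) + 1)),
      0 < ∑ j ∈ Finset.range (D + 1), F θ (u₀ + j * ((β - α) / ((D : ℝ) + 1))) := by
  rcases K.eq_empty_or_nonempty with rfl | hne
  · simp
  have hI : Continuous fun θ => ∫ u in α..β, F θ u :=
    intervalIntegral.continuous_parametric_intervalIntegral_of_continuous' hF α β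
  obtain ⟨θ₀, hθ₀, hmin⟩ := hK.exists_isMinOn hne hI.continuousOn
  set c := ∫ u in α..β, F θ₀ u with hc
  have hcpos : 0 < c := hpos θ₀ hθ₀
  have hβα : 0 < β - α := sub_pos.2 hαβ
  have hε : 0 < c / (2 * (β - α)) := by positivity
  have huc := (hK.prod (isCompact_Icc (a := α) (b := β))).uniformContinuousOn_of_continuous
    hF.continuousOn
  obtain ⟨δ, hδ, hd⟩ := Metric.uniformContinuousOn_iff.1 huc _ hε
  have hlim : Tendsto (fun D : ℕ => (β - α) * ((1 : ℝ) / ((D : ℝ) + 1))) atTop (𝓝 0) := by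
    simpa using (tendsto_one_div_add_atTop_nhds_zero_nat (𝕜 := ℝ)).const_mul (β - α)
  filter_upwards [hlim.eventually (gt_mem_nhds hδ)] with D hD θ hθ u₀ hu₀
  rw [mul_one_div] at hD
  set h := (β - α) / ((D : ℝ) + 1) with hh
  have hhpos : 0 < h := by positivity
  have hhD : ((D : ℝ) + 1) * h = β - α := by rw [hh]; field_simp
  have hcont : Continuous (F θ) := hF.comp (by fun_prop : Continuous fun u => (θ, u))
  have hsplit : ∫ u in α..β, F θ u =
      ∑ j ∈ Finset.range (D + 1), ∫ u in (α + j * h)..(α + (j + 1 : ℕ) * h), F θ u := by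
    rw [intervalIntegral.sum_integral_adjacent_intervals (a := fun j : ℕ => α + j * h)
      fun k _ => hcont.intervalIntegrable _ _]
    congr 1
    · simp
    · push_cast; linarith
  have hcell : ∀ j ∈ Finset.range (D + 1),
      ∫ u in (α + j * h)..(α + (j + 1 : ℕ) * h), F θ u ≤
        h * (F θ (u₀ + j * h) + c / (2 * (β - α))) := by
    intro j hj
    have hjD : (j : ℝ) + 1 ≤ D + 1 := by exact_mod_cast Finset.mem_range.1 hj
    have hj0 : 0 ≤ (j : ℝ) * h := by positivity
    have hj1 : ((j : ℝ) + 1) * h ≤ β - α := by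
      rw [← hhD]; exact mul_le_mul_of_nonneg_right hjD hhpos.le
    have hle : α + j * h ≤ α + (j + 1 : ℕ) * h := by push_cast; linarith
    have := intervalIntegral.integral_mono_on hle
        (hcont.intervalIntegrable (μ := MeasureTheory.volume) _ _)
      (g := fun _ => F θ (u₀ + j * h) + c / (2 * (β - α)))
      (continuous_const.intervalIntegrable _ _) ?_
    · refine this.trans_eq ?_
      rw [intervalIntegral.integral_const, smul_eq_mul]
      push_cast; ring
    · intro u hu
      have hu1 := hu.1
      have hu2 := hu.2
      push_cast at hu2
      have h1 := hd (θ, u) ⟨hθ, by constructor <;> simp only <;> linarith⟩ (θ, u₀ + j * h)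
        ⟨hθ, by constructor <;> simp only <;> linarith [hu₀.1, hu₀.2]⟩ (by
          rw [Prod.dist_eq, dist_self, max_eq_right dist_nonneg, Real.dist_eq]
          refine lt_of_le_of_lt ?_ hD
          rw [abs_le]
          constructor <;> linarith [hu₀.1, hu₀.2])
      rw [Real.dist_eq] at h1
      have := (abs_lt.1 h1).2
      simp only [Function.uncurry] at this
      linarith
  have hle : c ≤ ∫ u in α..β, F θ u := hmin hθ
  have hsum := Finset.sum_le_sum hcell
  rw [← hsplit, ← Finset.mul_sum, Finset.sum_add_distrib, Finset.sum_const, Finset.card_range,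
    nsmul_eq_mul, mul_add] at hsum
  have hhalf : h * (((D + 1 : ℕ) : ℝ) * (c / (2 * (β - α)))) = c / 2 := by
    push_cast
    rw [← mul_assoc, mul_comm h, hhD]
    field_simp
  have : 0 < h * ∑ j ∈ Finset.range (D + 1), F θ (u₀ + j * h) := by linarith
  exact pos_of_mul_pos_right this hhpos.le

/-- If `G` is positive on `[b - δ, b)`, then for large `θ` the function
`u ↦ G u * exp (θ * (u - (b - δ)))` dominates a function independent of `θ` whose integral is
positive: the exponential is at least `Θ * (u - (b - δ))` to the right of `b - δ` and at most `1` to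
the left. -/
theorem exists_minorant_of_pos_near_right_end {G : ℝ → ℝ} (hG : Continuous G) {a b δ : ℝ}
    (hδ : 0 < δ) (hb : ∀ u, b ≤ u → G u = 0)
    (hpos : ∀ u ∈ Set.Ico (b - δ) b, 0 < G u) :
    ∃ Θ : ℝ, 0 ≤ Θ ∧ ∃ ψ : ℝ → ℝ, Continuous ψ ∧
      (∀ α β : ℝ, a ≤ α → α ≤ b - δ → b - δ / 2 ≤ β → β ≤ b → 0 < ∫ u in α..β, ψ u) ∧
      ∀ θ : ℝ, Θ ≤ θ → ∀ u : ℝ, ψ u ≤ G u * Real.exp (θ * (u - (b - δ))) := by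
  set P : ℝ → ℝ := fun u => max (G u) 0 * max (u - (b - δ)) 0 with hP
  set Q : ℝ → ℝ := fun u => max (-G u) 0 with hQ
  have hPc : Continuous P := by fun_prop
  have hQc : Continuous Q := by fun_prop
  have hP0 : ∀ u, 0 ≤ P u := fun u => mul_nonneg (le_max_right _ _) (le_max_right _ _)
  have hQ0 : ∀ u, 0 ≤ Q u := fun u => le_max_right _ _
  have hIpos : 0 < ∫ u in (b - δ)..(b - δ / 2), P u := by
    refine intervalIntegral.intervalIntegral_pos_of_pos_on (hPc.intervalIntegrable _ _) ?_
      (by linarith)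
    intro u hu
    have h1 : 0 < G u := hpos u ⟨hu.1.le, by linarith [hu.2]⟩
    have h2 : 0 < u - (b - δ) := by linarith [hu.1]
    simp only [hP, max_eq_left h1.le, max_eq_left h2.le]
    positivity
  set I := ∫ u in (b - δ)..(b - δ / 2), P u with hI
  set J := max (∫ u in a..b, Q u) 0 with hJ
  have hJ0 : 0 ≤ J := le_max_right _ _
  refine ⟨(J + 1) / I, by positivity, fun u => (J + 1) / I * P u - Q u, by fun_prop, ?_, ?_⟩
  · intro α β h1 h2 h3 h4
    rw [intervalIntegral.integral_sub ((hPc.intervalIntegrable _ _).const_mul _)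
      (hQc.intervalIntegrable _ _), intervalIntegral.integral_const_mul]
    have hp : I ≤ ∫ u in α..β, P u :=
      intervalIntegral.integral_mono_interval h2 (by linarith) h3
        (Filter.Eventually.of_forall hP0) (hPc.intervalIntegrable _ _)
    have hq : ∫ u in α..β, Q u ≤ ∫ u in a..b, Q u :=
      intervalIntegral.integral_mono_interval h1 (by linarith) h4
        (Filter.Eventually.of_forall hQ0) (hQc.intervalIntegrable _ _)
    have hq' : ∫ u in α..β, Q u ≤ J := hq.trans (le_max_left _ _)
    have : (J + 1) / I * I ≤ (J + 1) / I * ∫ u in α..β, P u :=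
      mul_le_mul_of_nonneg_left hp (by positivity)
    rw [div_mul_cancel₀ _ hIpos.ne'] at this
    linarith
  · intro θ hθ u
    have hΘ : 0 ≤ (J + 1) / I := by positivity
    simp only [hP, hQ]
    generalize (J + 1) / I = Θ at hθ hΘ
    rcases le_or_gt (b - δ) u with hu | hu
    · have hg : 0 ≤ G u := by
        rcases lt_or_ge u b with hub | hub
        · exact (hpos u ⟨hu, hub⟩).le
        · exact (hb u hub).ge
      rw [max_eq_left hg, max_eq_left (sub_nonneg.2 hu), max_eq_right (by linarith)]
      have h1 : Θ * (u - (b - δ)) ≤ θ * (u - (b - δ)) :=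
        mul_le_mul_of_nonneg_right hθ (sub_nonneg.2 hu)
      have h2 := Real.add_one_le_exp (θ * (u - (b - δ)))
      nlinarith
    · rw [max_eq_right (by linarith : u - (b - δ) ≤ 0)]
      have h1 : Real.exp (θ * (u - (b - δ))) ≤ 1 := by
        rw [Real.exp_le_one_iff]
        exact mul_nonpos_of_nonneg_of_nonpos (hΘ.trans hθ) (by linarith)
      have h2 := Real.exp_pos (θ * (u - (b - δ)))
      rcases le_total 0 (G u) with hg | hg
      · rw [max_eq_right (by linarith : -G u ≤ 0)]
        nlinarith
      · rw [max_eq_left (by linarith : 0 ≤ -G u)]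
        nlinarith

/-! ### Convolution with binomial weights -/

/-- A positive power is the exponential of a multiple of `h ≠ 0`, so positivity of the exponential
sums along an arithmetic progression is positivity of a polynomial on the positive axis. -/
lemma sum_mul_pow_pos_of_forall_sum_exp_pos {n : ℕ} {f : ℕ → ℝ} {u h : ℝ} (hh : h ≠ 0)
    (H : ∀ θ : ℝ, 0 < ∑ j ∈ Finset.range n, f j * Real.exp (θ * (u + j * h)))
    {X : ℝ} (hX : 0 < X) : 0 < ∑ j ∈ Finset.range n, f j * X ^ j := by
  have := H (Real.log X / h)
  have e : ∑ j ∈ Finset.range n, f j * Real.exp (Real.log X / h * (u + j * h)) =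
      Real.exp (Real.log X / h * u) * ∑ j ∈ Finset.range n, f j * X ^ j := by
    rw [Finset.mul_sum]
    refine Finset.sum_congr rfl fun j _ => ?_
    have : Real.log X / h * (u + j * h) = Real.log X / h * u + j * Real.log X := by
      field_simp
    rw [this, Real.exp_add, Real.exp_nat_mul, Real.exp_log hX]
    ring
  rw [e] at this
  exact pos_of_mul_pos_right this (Real.exp_pos _).le

open Filter Topology in
/-- A function that vanishes outside `(a, b)`, is positive near both ends and has a positive Laplace
transform can be sampled along an arithmetic progression so finely that all the resulting
exponential sums are positive. The sampling interval `[α, α + (D + 1) * h]` lies slightly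
inside `[a, b]`, so that the first and the last sample are positive. -/
theorem exists_forall_sum_sample_exp_pos {G : ℝ → ℝ} (hG : Continuous G) {a b : ℝ}
    (hab : a < b) (ha : ∀ u ≤ a, G u = 0) (hb : ∀ u, b ≤ u → G u = 0)
    (hta : ∀ᶠ u in 𝓝[>] a, 0 < G u) (htb : ∀ᶠ u in 𝓝[<] b, 0 < G u)
    (hL : ∀ θ : ℝ, 0 < ∫ u in a..b, G u * Real.exp (θ * u)) :
    ∃ (α h : ℝ) (D : ℕ), 0 < h ∧ (∀ u ≤ α, 0 ≤ G u) ∧ (∀ u, α + (D + 1) * h ≤ u → 0 ≤ G u) ∧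
      ∀ u₀ ∈ Set.Icc α (α + h), 0 < G u₀ ∧ 0 < G (u₀ + D * h) ∧
        ∀ θ : ℝ, 0 < ∑ j ∈ Finset.range (D + 1),
          G (u₀ + j * h) * Real.exp (θ * (u₀ + j * h)) := by
  obtain ⟨a', ha', hpa⟩ := (mem_nhdsGT_iff_exists_Ioo_subset).1 hta
  obtain ⟨b', hb', hpb⟩ := (mem_nhdsLT_iff_exists_Ioo_subset).1 htb
  simp only [Set.mem_Ioi, Set.mem_Iio] at ha' hb'
  obtain ⟨δ, hδ, hδa, hδb, hδab⟩ : ∃ δ > 0, a + δ < a' ∧ b' < b - δ ∧ a + δ < b - δ := by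
    refine ⟨min (min (a' - a) (b - b')) (b - a) / 3, ?_, ?_, ?_, ?_⟩
    · have : 0 < min (min (a' - a) (b - b')) (b - a) :=
        lt_min (lt_min (sub_pos.2 ha') (sub_pos.2 hb')) (sub_pos.2 hab)
      positivity
    all_goals
      have h0 : 0 < min (min (a' - a) (b - b')) (b - a) :=
        lt_min (lt_min (sub_pos.2 ha') (sub_pos.2 hb')) (sub_pos.2 hab)
      have h1 := min_le_left (min (a' - a) (b - b')) (b - a)
      have h2 := min_le_right (min (a' - a) (b - b')) (b - a)
      have h3 := min_le_left (a' - a) (b - b')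
      have h4 := min_le_right (a' - a) (b - b')
      linarith
  have hGa : ∀ u ∈ Set.Ioc a (a + δ), 0 < G u := fun u hu => hpa ⟨hu.1, by linarith [hu.2]⟩
  have hGb : ∀ u ∈ Set.Ico (b - δ) b, 0 < G u := fun u hu => hpb ⟨by linarith [hu.1], hu.2⟩
  obtain ⟨Θ₁, hΘ₁, ψ₁, hψ₁, hint₁, hle₁⟩ :=
    exists_minorant_of_pos_near_right_end (a := a) hG hδ hb hGb
  -- The left end is treated by reflection.
  obtain ⟨Θ₂, hΘ₂, ψ₂, hψ₂, hint₂, hle₂⟩ :=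
    exists_minorant_of_pos_near_right_end (G := fun u => G (-u)) (a := -b) (b := -a)
      (hG.comp continuous_neg) hδ (fun u hu => ha _ (by linarith))
      (fun u hu => hGa _ ⟨by linarith [hu.2], by linarith [hu.1]⟩)
  set F : ℝ → ℝ → ℝ := fun θ u => G u * Real.exp (θ * u) with hF
  have hFc : Continuous (Function.uncurry F) := by
    have : Continuous fun z : ℝ × ℝ => G z.2 * Real.exp (z.1 * z.2) := by fun_prop
    exact this
  set K := Set.Icc (-Θ₂) Θ₁ with hK
  have hKc : IsCompact K := isCompact_Icc
  -- Truncating the interval slightly preserves positivity of the integrals for `θ ∈ K`.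
  have htrunc : ∀ᶠ ε in 𝓝 (0 : ℝ), ∀ θ ∈ K, 0 < ∫ u in (a + ε)..(b - ε), F θ u := by
    have hprim : Continuous fun z : ℝ × ℝ => ∫ u in a..z.2, F z.1 u :=
      intervalIntegral.continuous_parametric_primitive_of_continuous hFc
    have hdiff : Continuous fun z : ℝ × ℝ =>
        (∫ u in a..(b - z.1), F z.2 u) - ∫ u in a..(a + z.1), F z.2 u :=
      (hprim.comp (by fun_prop : Continuous fun z : ℝ × ℝ => (z.2, b - z.1))).sub
        (hprim.comp (by fun_prop : Continuous fun z : ℝ × ℝ => (z.2, a + z.1)))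
    have hev : ∀ᶠ ε in 𝓝 (0 : ℝ), ∀ θ ∈ K,
        0 < (∫ u in a..(b - ε), F θ u) - ∫ u in a..(a + ε), F θ u := by
      refine hKc.eventually_forall_of_forall_eventually fun θ _ => ?_
      exact hdiff.continuousAt.eventually (lt_mem_nhds (by simpa using hL θ))
    filter_upwards [hev] with ε hε θ hθ
    have hc : Continuous (F θ) := hFc.comp (by fun_prop : Continuous fun u => (θ, u))
    rw [← intervalIntegral.integral_interval_sub_left (hc.intervalIntegrable a (b - ε))
      (hc.intervalIntegrable a (a + ε))]
    exact hε θ hθ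
  obtain ⟨ε, hε, hε0⟩ :=
    ((htrunc.filter_mono nhdsWithin_le_nhds).and
      (Ioo_mem_nhdsGT (by linarith : (0 : ℝ) < δ / 2))).exists
  set α := a + ε with hα
  set β := b - ε with hβ
  have hαβ : α < β := by linarith [hε0.2]
  have hR := eventually_forall_riemannSum_pos hFc hKc hαβ hε
  have hR₁ := eventually_forall_riemannSum_pos (F := fun _ => ψ₁) (hψ₁.comp continuous_snd)
    (isCompact_singleton (x := (0 : ℝ))) hαβ
    (fun _ _ => hint₁ α β (by linarith [hε0.1]) (by linarith [hε0.2]) (by linarith [hε0.2])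
      (by linarith [hε0.1]))
  have hR₂ := eventually_forall_riemannSum_pos (F := fun _ u => ψ₂ (-u))
    (hψ₂.comp continuous_snd.neg)
    (isCompact_singleton (x := (0 : ℝ))) hαβ
    (fun _ _ => by
      rw [intervalIntegral.integral_comp_neg]
      exact hint₂ (-β) (-α) (by linarith [hε0.1]) (by linarith [hε0.2]) (by linarith [hε0.2])
        (by linarith [hε0.1]))
  have hlim : Tendsto (fun D : ℕ => (β - α) * ((1 : ℝ) / ((D : ℝ) + 1))) atTop (𝓝 0) := by
    simpa using (tendsto_one_div_add_atTop_nhds_zero_nat (𝕜 := ℝ)).const_mul (β - α)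
  obtain ⟨D, ⟨⟨hR, hR₁⟩, hR₂⟩, hD⟩ := (((hR.and hR₁).and hR₂).and
    (hlim.eventually (gt_mem_nhds (by linarith : (0 : ℝ) < δ / 2)))).exists
  rw [mul_one_div] at hD
  set h := (β - α) / ((D : ℝ) + 1) with hh
  have hhpos : 0 < h := div_pos (sub_pos.2 hαβ) (by positivity)
  have hhD : ((D : ℝ) + 1) * h = β - α := by rw [hh]; field_simp
  refine ⟨α, h, D, hhpos, fun u hu => ?_, fun u hu => ?_, fun u₀ hu₀ => ⟨?_, ?_, fun θ => ?_⟩⟩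
  · rcases le_or_gt u a with hua | hua
    · exact (ha u hua).ge
    · exact (hGa u ⟨hua, by linarith [hε0.2]⟩).le
  · rcases lt_or_ge u b with hub | hub
    · exact (hGb u ⟨by linarith [hε0.2], hub⟩).le
    · exact (hb u hub).ge
  · exact hGa u₀ ⟨by linarith [hu₀.1, hε0.1], by linarith [hu₀.2, hε0.2]⟩
  · exact hGb _ ⟨by linarith [hu₀.1, hε0.2], by linarith [hu₀.2, hε0.1]⟩
  · rcases le_total θ Θ₁ with h1 | h1
    · rcases le_total (-Θ₂) θ with h2 | h2
      · exact hR θ ⟨h2, h1⟩ u₀ hu₀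
      · have hs := hR₂ 0 rfl u₀ hu₀
        have hle := Finset.sum_le_sum fun j (_ : j ∈ Finset.range (D + 1)) =>
          hle₂ (-θ) (by linarith) (-(u₀ + j * h))
        have := hs.trans_le hle
        have e : ∀ j : ℕ, G (- -(u₀ + j * h)) *
            Real.exp (-θ * (-(u₀ + j * h) - (-a - δ))) =
            Real.exp (-θ * (a + δ)) * (G (u₀ + j * h) * Real.exp (θ * (u₀ + j * h))) := by
          intro j
          rw [neg_neg, mul_left_comm, ← Real.exp_add]
          ring_nf
        simp only [e, ← Finset.mul_sum] at this
        exact pos_of_mul_pos_right this (Real.exp_pos _).le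
    · have hs := hR₁ 0 rfl u₀ hu₀
      have hle := Finset.sum_le_sum fun j (_ : j ∈ Finset.range (D + 1)) =>
        hle₁ θ h1 (u₀ + j * h)
      have := hs.trans_le hle
      have e : ∀ j : ℕ, G (u₀ + j * h) * Real.exp (θ * (u₀ + j * h - (b - δ))) =
          Real.exp (-θ * (b - δ)) * (G (u₀ + j * h) * Real.exp (θ * (u₀ + j * h))) := by
        intro j
        rw [mul_left_comm, ← Real.exp_add]
        ring_nf
      simp only [e, ← Finset.mul_sum] at this
      exact pos_of_mul_pos_right this (Real.exp_pos _).le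

/-- Nonnegativity of a binomial sum of samples follows from that of the sum over the window
`0 ≤ j ≤ D` of indices when all samples outside this window are nonnegative. -/
lemma sum_choose_mul_nonneg_of_window {N D : ℕ} {g : ℤ → ℝ} (hneg : ∀ j < 0, 0 ≤ g j)
    (hbig : ∀ j : ℤ, (D : ℤ) < j → 0 ≤ g j)
    (hwin : ∀ m n : ℕ, m + n = N + D → 0 ≤ ∑ j ∈ Finset.range (D + 1),
      g j * ((m.descFactorial j : ℝ) * (n.descFactorial (D - j) : ℝ))) (m : ℤ) :
    0 ≤ ∑ k ∈ Finset.range (N + 1), (N.choose k : ℝ) * g (m - k) := by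
  rcases lt_or_ge m 0 with hm | hm
  · exact Finset.sum_nonneg fun k _ => mul_nonneg (by positivity) (hneg _ (by omega))
  obtain ⟨m, rfl⟩ := Int.eq_ofNat_of_zero_le hm
  rcases lt_or_ge (N + D) m with hmD | hmD
  · refine Finset.sum_nonneg fun k hk => mul_nonneg (by positivity) (hbig _ ?_)
    have := Finset.mem_range.1 hk
    omega
  obtain ⟨n, hn⟩ := Nat.exists_eq_add_of_le hmD
  have hw := hwin m n hn.symm
  have hfac : (0 : ℝ) < N.factorial := by positivity
  have hfac' : (0 : ℝ) < m.factorial * n.factorial := by positivity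
  have hw2 : 0 ≤ ∑ j ∈ Finset.range (D + 1),
      g j * (if j ≤ m then (N.choose (m - j) : ℝ) else 0) := by
    refine nonneg_of_mul_nonneg_left ?_ hfac'
    have := mul_nonneg hfac.le hw
    rw [Finset.mul_sum] at this
    rw [Finset.sum_mul]
    refine this.trans_eq (Finset.sum_congr rfl fun j hj => ?_)
    have hj : j ≤ D := by
      have := Finset.mem_range.1 hj
      omega
    rw [mul_assoc, choose_mul_factorial_mul_factorial_eq hj hn.symm]
    ring
  refine hw2.trans ?_
  rw [← Finset.sum_filter_add_sum_filter_not (Finset.range (N + 1))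
    (fun k => k ≤ m ∧ m ≤ D + k)]
  have hrest : 0 ≤ ∑ k ∈ (Finset.range (N + 1)).filter (fun k => ¬ (k ≤ m ∧ m ≤ D + k)),
      (N.choose k : ℝ) * g ((m : ℤ) - k) := by
    refine Finset.sum_nonneg fun k hk => mul_nonneg (by positivity) ?_
    have hk := (Finset.mem_filter.1 hk).2
    rcases lt_or_ge m k with h | h
    · exact hneg _ (by omega)
    · exact hbig _ (by omega)
  refine le_add_of_le_of_nonneg (le_of_eq ?_) hrest
  -- Reindex by `j = m - k`; indices with `N < m - j` contribute zero.
  have hzero : ∑ j ∈ (Finset.range (D + 1)).filter (fun j => ¬ (j ≤ m ∧ m ≤ N + j)),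
      g j * (if j ≤ m then (N.choose (m - j) : ℝ) else 0) = 0 := by
    refine Finset.sum_eq_zero fun j hj => ?_
    simp only [Finset.mem_filter, Finset.mem_range] at hj
    split_ifs with h
    · rw [Nat.choose_eq_zero_of_lt (by omega)]
      simp
    · simp
  rw [← Finset.sum_filter_add_sum_filter_not (Finset.range (D + 1))
    (fun j => j ≤ m ∧ m ≤ N + j), hzero, add_zero]
  refine Finset.sum_bij' (fun j _ => m - j) (fun k _ => m - k) ?_ ?_ ?_ ?_ ?_
  · intro j hj
    simp only [Finset.mem_filter, Finset.mem_range] at hj ⊢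
    omega
  · intro k hk
    simp only [Finset.mem_filter, Finset.mem_range] at hk ⊢
    omega
  · intro j hj
    simp only [Finset.mem_filter, Finset.mem_range] at hj
    omega
  · intro k hk
    simp only [Finset.mem_filter, Finset.mem_range] at hk
    omega
  · intro j hj
    simp only [Finset.mem_filter, Finset.mem_range] at hj
    rw [if_pos hj.2.1, Nat.cast_sub hj.2.1, sub_sub_cancel, mul_comm]

open Filter Topology in
/-- A continuous function that vanishes outside `(a, b)`, is positive near both ends and has a
positive Laplace transform becomes nonnegative after convolution with a suitable binomial
distribution on an arithmetic progression. -/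
theorem exists_forall_sum_choose_mul_nonneg {G : ℝ → ℝ} (hG : Continuous G) {a b : ℝ}
    (hab : a < b) (ha : ∀ u ≤ a, G u = 0) (hb : ∀ u, b ≤ u → G u = 0)
    (hta : ∀ᶠ u in 𝓝[>] a, 0 < G u) (htb : ∀ᶠ u in 𝓝[<] b, 0 < G u)
    (hL : ∀ θ : ℝ, 0 < ∫ u in a..b, G u * Real.exp (θ * u)) :
    ∃ (N : ℕ) (h : ℝ), ∀ u : ℝ,
      0 ≤ ∑ k ∈ Finset.range (N + 1), (N.choose k : ℝ) * G (u - k * h) := by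
  obtain ⟨α, h, D, hh, hlo, hhi, hwin⟩ :=
    exists_forall_sum_sample_exp_pos hG hab ha hb hta htb hL
  obtain ⟨N, hN⟩ := exists_forall_sum_descFactorial_nonneg (isCompact_Icc (a := α) (b := α + h)) D
    (fun s j => G (s + j * h)) (fun j => hG.comp (by fun_prop))
    (fun s hs => by simpa using (hwin s hs).1) (fun s hs => (hwin s hs).2.1)
    (fun s hs X hX => sum_mul_pow_pos_of_forall_sum_exp_pos hh.ne' (hwin s hs).2.2 hX)
  refine ⟨N, h, fun u => ?_⟩
  set m : ℤ := ⌊(u - α) / h⌋ with hm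
  set s : ℝ := u - m * h with hs
  have hm1 : (m : ℝ) * h ≤ u - α := by
    rw [← le_div_iff₀ hh]; exact Int.floor_le _
  have hm2 : u - α < ((m : ℝ) + 1) * h := by
    rw [← div_lt_iff₀ hh]; exact Int.lt_floor_add_one _
  have hsα : s ∈ Set.Icc α (α + h) := ⟨by linarith, by linarith⟩
  have key := sum_choose_mul_nonneg_of_window (N := N) (D := D) (g := fun j : ℤ => G (s + j * h))
    (fun j hj => hlo _ ?_) (fun j hj => hhi _ ?_)
    (fun m n hmn => by simpa using hN s hsα m n hmn) m
  · refine key.trans_eq (Finset.sum_congr rfl fun k _ => ?_)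
    congr 2
    rw [hs]
    push_cast
    ring
  · have : (j : ℝ) + 1 ≤ 0 := by exact_mod_cast hj
    nlinarith [hsα.2]
  · have : (D : ℝ) + 1 ≤ j := by exact_mod_cast hj
    nlinarith [hsα.1]

/-! ### Signed sums of hinge functions in logarithmic coordinates -/

/-- The hinge sum `t ↦ ∑ v, w v * max (v - t) 0` of the signed measure with mass `w v` at `v ∈ S`, in
the logarithmic coordinate `t = exp u` and divided by `t`. With this normalization rescaling the
atoms by a common factor becomes a translation. -/
noncomputable def logHinge (S : Finset ℝ) (w : ℝ → ℝ) (u : ℝ) : ℝ :=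
  ∑ v ∈ S, w v * max (v * Real.exp (-u) - 1) 0

lemma continuous_logHinge (S : Finset ℝ) (w : ℝ → ℝ) : Continuous (logHinge S w) := by
  unfold logHinge
  fun_prop

lemma logHinge_eq_zero_of_le_exp {S : Finset ℝ} (w : ℝ → ℝ) {u : ℝ}
    (h : ∀ v ∈ S, v ≤ Real.exp u) : logHinge S w u = 0 := by
  refine Finset.sum_eq_zero fun v hv => ?_
  have : v * Real.exp (-u) ≤ 1 := by
    rw [Real.exp_neg, ← div_eq_mul_inv, div_le_one (Real.exp_pos u)]
    exact h v hv
  rw [max_eq_right (by linarith), mul_zero]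

/-- When the total mass and the first moment vanish, the hinges may be turned to the left. -/
lemma logHinge_eq_sum_left {S : Finset ℝ} {w : ℝ → ℝ} (h0 : ∑ v ∈ S, w v = 0)
    (h1 : ∑ v ∈ S, w v * v = 0) (u : ℝ) :
    logHinge S w u = ∑ v ∈ S, w v * max (1 - v * Real.exp (-u)) 0 := by
  have e : ∀ v, w v * max (v * Real.exp (-u) - 1) 0 =
      w v * max (1 - v * Real.exp (-u)) 0 + (w v * v * Real.exp (-u) - w v) := by
    intro v
    rcases le_total 1 (v * Real.exp (-u)) with h | h
    · rw [max_eq_left (by linarith), max_eq_right (by linarith)]; ring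
    · rw [max_eq_right (by linarith), max_eq_left (by linarith)]; ring
  simp only [logHinge, e, Finset.sum_add_distrib, Finset.sum_sub_distrib, ← Finset.sum_mul, h0, h1]
  ring

lemma logHinge_eq_zero_of_exp_le {S : Finset ℝ} {w : ℝ → ℝ} (h0 : ∑ v ∈ S, w v = 0)
    (h1 : ∑ v ∈ S, w v * v = 0) {u : ℝ} (h : ∀ v ∈ S, Real.exp u ≤ v) : logHinge S w u = 0 := by
  rw [logHinge_eq_sum_left h0 h1]
  refine Finset.sum_eq_zero fun v hv => ?_
  have : 1 ≤ v * Real.exp (-u) := by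
    rw [Real.exp_neg, ← div_eq_mul_inv, le_div_iff₀ (Real.exp_pos u), one_mul]
    exact h v hv
  rw [max_eq_right (by linarith), mul_zero]

open Filter Topology in
lemma eventually_logHinge_pos_left_of_max {S : Finset ℝ} {w : ℝ → ℝ} {b : ℝ} (hb : b ∈ S)
    (hb0 : 0 < b) (hmax : ∀ v ∈ S, v ≤ b) (hw : 0 < w b) :
    ∀ᶠ u in 𝓝[<] (Real.log b), 0 < logHinge S w u := by
  have hev : ∀ᶠ u in 𝓝[<] (Real.log b), ∀ v ∈ S, v ≠ b → v < Real.exp u := by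
    refine nhdsWithin_le_nhds ?_
    rw [← Filter.Eventually, Filter.eventually_all_finset]
    intro v hv
    by_cases hvb : v = b
    · simp [hvb]
    · have : v < Real.exp (Real.log b) := by
        rw [Real.exp_log hb0]; exact lt_of_le_of_ne (hmax v hv) hvb
      filter_upwards [Real.continuous_exp.continuousAt.eventually (lt_mem_nhds this)] with u hu _
      exact hu
  filter_upwards [hev, self_mem_nhdsWithin] with u hu hub
  have hub : Real.exp u < b := (Real.lt_log_iff_exp_lt hb0).1 hub
  have h1 : 1 < b * Real.exp (-u) := by
    rwa [Real.exp_neg, ← div_eq_mul_inv, one_lt_div (Real.exp_pos u)]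
  rw [logHinge, Finset.sum_eq_single b]
  · rw [max_eq_left (by linarith)]
    exact mul_pos hw (by linarith)
  · intro v hv hvb
    have : v * Real.exp (-u) < 1 := by
      rw [Real.exp_neg, ← div_eq_mul_inv, div_lt_one (Real.exp_pos u)]
      exact hu v hv hvb
    rw [max_eq_right (by linarith), mul_zero]
  · exact fun h => absurd hb h

open Filter Topology in
lemma eventually_logHinge_pos_right_of_min {S : Finset ℝ} {w : ℝ → ℝ} (h0 : ∑ v ∈ S, w v = 0)
    (h1 : ∑ v ∈ S, w v * v = 0) {a : ℝ} (ha : a ∈ S)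
    (ha0 : 0 < a) (hmin : ∀ v ∈ S, a ≤ v) (hw : 0 < w a) :
    ∀ᶠ u in 𝓝[>] (Real.log a), 0 < logHinge S w u := by
  have hev : ∀ᶠ u in 𝓝[>] (Real.log a), ∀ v ∈ S, v ≠ a → Real.exp u < v := by
    refine nhdsWithin_le_nhds ?_
    rw [← Filter.Eventually, Filter.eventually_all_finset]
    intro v hv
    by_cases hva : v = a
    · simp [hva]
    · have : Real.exp (Real.log a) < v := by
        rw [Real.exp_log ha0]; exact lt_of_le_of_ne (hmin v hv) (Ne.symm hva)
      filter_upwards [Real.continuous_exp.continuousAt.eventually (gt_mem_nhds this)] with u hu _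
      exact hu
  filter_upwards [hev, self_mem_nhdsWithin] with u hu hua
  have hua : a < Real.exp u := (Real.log_lt_iff_lt_exp ha0).1 hua
  have h2 : a * Real.exp (-u) < 1 := by
    rwa [Real.exp_neg, ← div_eq_mul_inv, div_lt_one (Real.exp_pos u)]
  rw [logHinge_eq_sum_left h0 h1, Finset.sum_eq_single a]
  · rw [max_eq_left (by linarith)]
    exact mul_pos hw (by linarith)
  · intro v hv hva
    have : 1 < v * Real.exp (-u) := by
      rw [Real.exp_neg, ← div_eq_mul_inv, one_lt_div (Real.exp_pos u)]
      exact hu v hv hva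
    rw [max_eq_right (by linarith), mul_zero]
  · exact fun h => absurd ha h

open Filter Topology in
/-- The largest atom governs power sums of large positive order. -/
lemma tendsto_sum_mul_rpow_div_atTop {S : Finset ℝ} (w : ℝ → ℝ) (hS : ∀ v ∈ S, 0 < v) {b : ℝ}
    (hb : b ∈ S) (hmax : ∀ v ∈ S, v ≤ b) :
    Tendsto (fun p : ℝ => (∑ v ∈ S, w v * v ^ p) / b ^ p) atTop (𝓝 (w b)) := by
  have hlim : Tendsto (fun p : ℝ => ∑ v ∈ S, w v * (v / b) ^ p) atTop
      (𝓝 (∑ v ∈ S, w v * if v = b then 1 else 0)) := by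
    refine tendsto_finsetSum _ fun v hv => Tendsto.const_mul _ ?_
    split_ifs with h
    · subst h
      refine tendsto_const_nhds.congr fun p => ?_
      rw [div_self (hS v hv).ne', Real.one_rpow]
    · have hvb : v < b := lt_of_le_of_ne (hmax v hv) h
      refine tendsto_rpow_atTop_of_base_lt_one _ ?_ ?_
      · linarith [div_pos (hS v hv) (hS b hb)]
      · rwa [div_lt_one (hS b hb)]
  simp only [mul_ite, mul_one, mul_zero, Finset.sum_ite_eq', hb, if_true] at hlim
  refine hlim.congr fun p => ?_
  rw [Finset.sum_div]
  refine Finset.sum_congr rfl fun v hv => ?_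
  rw [Real.div_rpow (hS v hv).le (hS b hb).le, mul_div_assoc]

open Filter Topology in
/-- The smallest atom governs power sums of large negative order. -/
lemma tendsto_sum_mul_rpow_div_atBot {S : Finset ℝ} (w : ℝ → ℝ) (hS : ∀ v ∈ S, 0 < v) {a : ℝ}
    (ha : a ∈ S) (hmin : ∀ v ∈ S, a ≤ v) :
    Tendsto (fun p : ℝ => (∑ v ∈ S, w v * v ^ p) / a ^ p) atBot (𝓝 (w a)) := by
  have hlim : Tendsto (fun p : ℝ => ∑ v ∈ S, w v * (v / a) ^ p) atBot
      (𝓝 (∑ v ∈ S, w v * if v = a then 1 else 0)) := by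
    refine tendsto_finsetSum _ fun v hv => Tendsto.const_mul _ ?_
    split_ifs with h
    · subst h
      refine tendsto_const_nhds.congr fun p => ?_
      rw [div_self (hS v hv).ne', Real.one_rpow]
    · have hva : a < v := lt_of_le_of_ne (hmin v hv) (Ne.symm h)
      refine tendsto_rpow_atBot_of_base_gt_one _ ?_
      rwa [one_lt_div (hS a ha)]
  simp only [mul_ite, mul_one, mul_zero, Finset.sum_ite_eq', ha, if_true] at hlim
  refine hlim.congr fun p => ?_
  rw [Finset.sum_div]
  refine Finset.sum_congr rfl fun v hv => ?_
  rw [Real.div_rpow (hS v hv).le (hS a ha).le, mul_div_assoc]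

lemma mul_integral_hinge_mul_exp {v α β : ℝ} (hv : 0 < v) (hα : α ≤ Real.log v)
    (hβ : Real.log v ≤ β) (p : ℝ) :
    p * (p - 1) * ∫ u in α..β, max (v * Real.exp (-u) - 1) 0 * Real.exp (p * u) =
      v ^ p - p * v * Real.exp ((p - 1) * α) + (p - 1) * Real.exp (p * α) := by
  have hc : Continuous fun u : ℝ => max (v * Real.exp (-u) - 1) 0 * Real.exp (p * u) := by
    fun_prop
  rw [← intervalIntegral.integral_add_adjacent_intervals (hc.intervalIntegrable α (Real.log v))
    (hc.intervalIntegrable (Real.log v) β)]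
  have hright : ∫ u in (Real.log v)..β, max (v * Real.exp (-u) - 1) 0 * Real.exp (p * u) = 0 := by
    rw [intervalIntegral.integral_congr (g := fun _ => (0 : ℝ)), intervalIntegral.integral_zero]
    intro u hu
    rw [Set.uIcc_of_le hβ] at hu
    have h1 : v ≤ Real.exp u := (Real.log_le_iff_le_exp hv).1 hu.1
    have : v * Real.exp (-u) ≤ 1 := by
      rwa [Real.exp_neg, ← div_eq_mul_inv, div_le_one (Real.exp_pos u)]
    simp only
    rw [max_eq_right (by linarith), zero_mul]
  have hleft : p * (p - 1) *
      ∫ u in α..(Real.log v), max (v * Real.exp (-u) - 1) 0 * Real.exp (p * u) =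
      ∫ u in α..(Real.log v),
        (p * v * (Real.exp ((p - 1) * u) * (p - 1)) - (p - 1) * (Real.exp (p * u) * p)) := by
    rw [← intervalIntegral.integral_const_mul]
    refine intervalIntegral.integral_congr fun u hu => ?_
    rw [Set.uIcc_of_le hα] at hu
    have h1 : Real.exp u ≤ v := (Real.le_log_iff_exp_le hv).1 hu.2
    have : 1 ≤ v * Real.exp (-u) := by
      rwa [Real.exp_neg, ← div_eq_mul_inv, one_le_div (Real.exp_pos u)]
    rw [max_eq_left (by linarith), show (p - 1) * u = p * u + -u by ring, Real.exp_add]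
    ring
  rw [hright, add_zero, hleft, intervalIntegral.integral_eq_sub_of_hasDerivAt
    (f := fun u => p * v * Real.exp ((p - 1) * u) - (p - 1) * Real.exp (p * u))]
  · rw [Real.rpow_def_of_pos hv, show (p - 1) * Real.log v = Real.log v * p - Real.log v by ring,
      Real.exp_sub, Real.exp_log hv, mul_comm p (Real.log v)]
    field_simp
    ring
  · intro u _
    have h1 := ((hasDerivAt_id u).const_mul (p - 1)).exp.const_mul (p * v)
    have h2 := ((hasDerivAt_id u).const_mul p).exp.const_mul (p - 1)
    have h3 := h1.fun_sub h2
    simpa using h3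
  · exact (by fun_prop : Continuous fun u : ℝ =>
      p * v * (Real.exp ((p - 1) * u) * (p - 1)) - (p - 1) * (Real.exp (p * u) * p))
        |>.intervalIntegrable _ _

/-- The Laplace transform of the hinge sum is the power sum divided by `p * (p - 1)`. -/
theorem mul_integral_logHinge_mul_exp {S : Finset ℝ} {w : ℝ → ℝ} (hS : ∀ v ∈ S, 0 < v)
    (h0 : ∑ v ∈ S, w v = 0) (h1 : ∑ v ∈ S, w v * v = 0) {α β : ℝ}
    (hα : ∀ v ∈ S, α ≤ Real.log v) (hβ : ∀ v ∈ S, Real.log v ≤ β) (p : ℝ) :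
    p * (p - 1) * ∫ u in α..β, logHinge S w u * Real.exp (p * u) = ∑ v ∈ S, w v * v ^ p := by
  have e : ∫ u in α..β, logHinge S w u * Real.exp (p * u) =
      ∑ v ∈ S, w v * ∫ u in α..β, max (v * Real.exp (-u) - 1) 0 * Real.exp (p * u) := by
    simp only [logHinge, Finset.sum_mul]
    rw [intervalIntegral.integral_finsetSum]
    · refine Finset.sum_congr rfl fun v _ => ?_
      rw [← intervalIntegral.integral_const_mul]
      simp only [mul_assoc]
    · intro v _
      exact (by fun_prop : Continuous fun u : ℝ =>
        w v * max (v * Real.exp (-u) - 1) 0 * Real.exp (p * u)).intervalIntegrable _ _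
  rw [e, Finset.mul_sum]
  have e2 : ∀ v ∈ S, p * (p - 1) *
      (w v * ∫ u in α..β, max (v * Real.exp (-u) - 1) 0 * Real.exp (p * u)) =
      w v * v ^ p - w v * v * (p * Real.exp ((p - 1) * α)) +
        w v * ((p - 1) * Real.exp (p * α)) := by
    intro v hv
    rw [mul_left_comm, mul_integral_hinge_mul_exp (hS v hv) (hα v hv) (hβ v hv)]
    ring
  rw [Finset.sum_congr rfl e2, Finset.sum_add_distrib, Finset.sum_sub_distrib, ← Finset.sum_mul,
    ← Finset.sum_mul, h0, h1]
  ring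

/-- For a signed measure with vanishing mass and first moment: some convolution of the hinge sum
with finitely many unit masses is nonnegative if and only if its Laplace transform is positive. In
the direction from right to left the unit masses have the binomial multiplicities. -/
theorem exists_sum_logHinge_nonneg_iff {S : Finset ℝ} {w : ℝ → ℝ} (hS : ∀ v ∈ S, 0 < v)
    (hne : S.Nonempty) (hw : ∀ v ∈ S, w v ≠ 0) (h0 : ∑ v ∈ S, w v = 0)
    (h1 : ∑ v ∈ S, w v * v = 0) :
    (∃ n : ℕ, 1 ≤ n ∧ ∃ γ : Fin n → ℝ, ∀ u, 0 ≤ ∑ j, logHinge S w (u - γ j)) ↔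
      ∀ p : ℝ, 0 < ∫ u in (Real.log (S.min' hne))..(Real.log (S.max' hne)),
        logHinge S w u * Real.exp (p * u) := by
  set a := S.min' hne with ha
  set b := S.max' hne with hb
  have haS : a ∈ S := S.min'_mem hne
  have hbS : b ∈ S := S.max'_mem hne
  have hmin : ∀ v ∈ S, a ≤ v := fun v hv => S.min'_le v hv
  have hmax : ∀ v ∈ S, v ≤ b := fun v hv => S.le_max' v hv
  have ha0 : 0 < a := hS a haS
  have hb0 : 0 < b := hS b hbS
  set G := logHinge S w with hG
  have hGc : Continuous G := continuous_logHinge S w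
  have hGa : ∀ u ≤ Real.log a, G u = 0 := fun u hu =>
    logHinge_eq_zero_of_exp_le h0 h1 fun v hv =>
      ((Real.le_log_iff_exp_le ha0).1 hu).trans (hmin v hv)
  have hGb : ∀ u, Real.log b ≤ u → G u = 0 := fun u hu =>
    logHinge_eq_zero_of_le_exp w fun v hv =>
      (hmax v hv).trans ((Real.log_le_iff_le_exp hb0).1 hu)
  have hlap := mul_integral_logHinge_mul_exp hS h0 h1 (α := Real.log a) (β := Real.log b)
    (fun v hv => Real.log_le_log ha0 (hmin v hv))
    (fun v hv => Real.log_le_log (hS v hv) (hmax v hv))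
  have htop := tendsto_sum_mul_rpow_div_atTop w hS hbS hmax
  have hbot := tendsto_sum_mul_rpow_div_atBot w hS haS hmin
  constructor
  · rintro ⟨n, hn, γ, hγ⟩ p
    have hsupp : HasCompactSupport G :=
      HasCompactSupport.intro (isCompact_Icc (a := Real.log a) (b := Real.log b)) fun u hu => by
        rw [Set.mem_Icc, not_and_or, not_le, not_le] at hu
        exact hu.elim (fun h => hGa u h.le) fun h => hGb u h.le
    have hint : ∀ p : ℝ, MeasureTheory.Integrable fun u => G u * Real.exp (p * u) := fun p =>
      (hGc.mul (by fun_prop : Continuous fun u : ℝ => Real.exp (p * u)))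
        |>.integrable_of_hasCompactSupport hsupp.mul_right
    have hline : ∀ p : ℝ, ∫ u in (Real.log a)..(Real.log b), G u * Real.exp (p * u) =
        ∫ u, G u * Real.exp (p * u) := fun p => by
      refine intervalIntegral.integral_eq_integral_of_support_subset fun u hu => ?_
      have hGu : G u ≠ 0 := left_ne_zero_of_mul hu
      exact ⟨not_le.1 fun h => hGu (hGa u h), not_lt.1 fun h => hGu (hGb u h.le)⟩
    have hshift : ∀ p c u : ℝ, G (u - c) * Real.exp (p * u) =
        Real.exp (p * c) * (G (u - c) * Real.exp (p * (u - c))) := by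
      intro p c u
      rw [mul_left_comm, ← Real.exp_add]
      ring_nf
    have hint' : ∀ p c : ℝ, MeasureTheory.Integrable fun u => G (u - c) * Real.exp (p * u) :=
      fun p c => by
        simp only [hshift]
        exact ((hint p).comp_sub_right c).const_mul _
    have hconv : ∀ p : ℝ, ∫ u, (∑ j, G (u - γ j)) * Real.exp (p * u) =
        (∑ j, Real.exp (p * γ j)) * ∫ u, G u * Real.exp (p * u) := by
      intro p
      simp only [Finset.sum_mul]
      rw [MeasureTheory.integral_finsetSum _ fun j _ => hint' p (γ j)]
      refine Finset.sum_congr rfl fun j _ => ?_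
      simp only [hshift]
      rw [MeasureTheory.integral_const_mul,
        MeasureTheory.integral_sub_right_eq_self (fun u => G u * Real.exp (p * u))]
    have hsum : ∀ p : ℝ, 0 < ∑ j, Real.exp (p * γ j) := fun p =>
      Finset.sum_pos (fun _ _ => Real.exp_pos _) ⟨⟨0, hn⟩, Finset.mem_univ _⟩
    -- If the convolution vanished identically, so would all power sums.
    obtain ⟨u₁, hu₁⟩ : ∃ u, ∑ j, G (u - γ j) ≠ 0 := by
      by_contra! hzero
      have hL : ∀ p : ℝ, ∫ u, G u * Real.exp (p * u) = 0 := fun p => by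
        have := hconv p
        simp only [hzero, zero_mul, MeasureTheory.integral_zero] at this
        exact (mul_eq_zero.1 this.symm).resolve_left (hsum p).ne'
      have hz : ∀ p : ℝ, ∑ v ∈ S, w v * v ^ p = 0 := fun p => by
        rw [← hlap p, hline, hL, mul_zero]
      simp only [hz, zero_div] at htop
      exact hw b hbS (tendsto_nhds_unique htop tendsto_const_nhds)
    have hpos : 0 < ∫ u, (∑ j, G (u - γ j)) * Real.exp (p * u) := by
      refine MeasureTheory.integral_pos_of_integrable_nonneg_nonzero (x := u₁) (by fun_prop) ?_
        (fun u => mul_nonneg (hγ u) (Real.exp_pos _).le)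
        (mul_ne_zero hu₁ (Real.exp_pos _).ne')
      simp only [Finset.sum_mul]
      exact MeasureTheory.integrable_finsetSum _ fun j _ => hint' p (γ j)
    rw [hconv] at hpos
    rw [hline]
    exact pos_of_mul_pos_right hpos (hsum p).le
  · intro hL
    have hab : Real.log a < Real.log b := by
      by_contra! h
      have h' : Real.log b = Real.log a := le_antisymm h (Real.log_le_log ha0 (hmin b hbS))
      simpa [h'] using hL 0
    have hwb : 0 < w b := by
      refine lt_of_le_of_ne (ge_of_tendsto htop ?_) (hw b hbS).symm
      filter_upwards [Filter.eventually_gt_atTop 1] with p hp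
      rw [← hlap p]
      have : 0 < p * (p - 1) := mul_pos (by linarith) (by linarith)
      have := hL p
      positivity
    have hwa : 0 < w a := by
      refine lt_of_le_of_ne (ge_of_tendsto hbot ?_) (hw a haS).symm
      filter_upwards [Filter.eventually_lt_atBot 0] with p hp
      rw [← hlap p]
      have : 0 < p * (p - 1) := mul_pos_of_neg_of_neg hp (by linarith)
      have := hL p
      positivity
    obtain ⟨N, h, hN⟩ := exists_forall_sum_choose_mul_nonneg hGc hab hGa hGb
      (eventually_logHinge_pos_right_of_min h0 h1 haS ha0 hmin hwa)
      (eventually_logHinge_pos_left_of_max hbS hb0 hmax hwb) hL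
    -- The subsets of an `N`-element set realize the binomial multiplicities.
    let e := Fintype.equivFin (Finset (Fin N))
    refine ⟨Fintype.card (Finset (Fin N)), Fintype.card_pos,
      fun j => ((e.symm j).card : ℝ) * h, fun u => ?_⟩
    rw [e.symm.sum_comp (fun s : Finset (Fin N) => G (u - (s.card : ℝ) * h)),
      ← Finset.powerset_univ, Finset.sum_powerset_apply_card (fun k : ℕ => G (u - k * h))]
    simpa using hN u

/-! ### Trumping and the Dirichlet polynomial -/

/-- The signed multiplicity of `v`: how much more often it occurs in `y` than in `x`. -/
noncomputable def multiplicityDiff {d : ℕ} (x y : Fin d → ℝ) (v : ℝ) : ℝ :=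
  ((Finset.univ.filter fun i => y i = v).card : ℝ) - (Finset.univ.filter fun i => x i = v).card

/-- The finite set of values which do not occur equally often in `x` and in `y`. -/
noncomputable def differingValues {d : ℕ} (x y : Fin d → ℝ) : Finset ℝ :=
  (Finset.univ.image x ∪ Finset.univ.image y).filter fun v => multiplicityDiff x y v ≠ 0

lemma sum_sub_sum_eq_sum_union {d : ℕ} (x y : Fin d → ℝ) (f : ℝ → ℝ) :
    ∑ i, f (y i) - ∑ i, f (x i) = ∑ v ∈ Finset.univ.image x ∪ Finset.univ.image y,
      multiplicityDiff x y v * f v := by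
  have h : ∀ z : Fin d → ℝ, Finset.univ.image z ⊆ Finset.univ.image x ∪ Finset.univ.image y →
      ∑ i, f (z i) = ∑ v ∈ Finset.univ.image x ∪ Finset.univ.image y,
        ((Finset.univ.filter fun i => z i = v).card : ℝ) * f v := by
    intro z hz
    rw [← Finset.sum_fiberwise_of_maps_to (g := z) fun i _ =>
      hz (Finset.mem_image_of_mem z (Finset.mem_univ i))]
    refine Finset.sum_congr rfl fun v _ => ?_
    rw [Finset.sum_congr rfl fun i hi => by rw [(Finset.mem_filter.1 hi).2], Finset.sum_const,
      nsmul_eq_mul]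
  rw [h y Finset.subset_union_right, h x Finset.subset_union_left, ← Finset.sum_sub_distrib]
  exact Finset.sum_congr rfl fun v _ => by rw [multiplicityDiff]; ring

lemma sum_sub_sum_eq_sum_differingValues {d : ℕ} (x y : Fin d → ℝ) (f : ℝ → ℝ) :
    ∑ i, f (y i) - ∑ i, f (x i) =
      ∑ v ∈ differingValues x y, multiplicityDiff x y v * f v := by
  rw [sum_sub_sum_eq_sum_union, differingValues]
  refine (Finset.sum_filter_of_ne fun v _ hv => ?_).symm
  exact left_ne_zero_of_mul hv

lemma differingValues_nonempty {d : ℕ} {x y : Fin d → ℝ}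
    (h : decreasingRearrangement x ≠ decreasingRearrangement y) :
    (differingValues x y).Nonempty := by
  by_contra hne
  rw [Finset.not_nonempty_iff_eq_empty] at hne
  have hz : ∀ v, multiplicityDiff x y v = 0 := by
    intro v
    by_contra hv
    have : v ∈ differingValues x y := by
      refine Finset.mem_filter.2 ⟨?_, hv⟩
      by_contra hmem
      simp only [Finset.mem_union, Finset.mem_image, Finset.mem_univ, true_and, not_or,
        not_exists] at hmem
      simp [multiplicityDiff, hmem.1, hmem.2] at hv
    simp [hne] at this
  refine h ?_
  rw [decreasingRearrangement, decreasingRearrangement]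
  congr 1
  refine Multiset.ext.2 fun v => ?_
  have hv := sub_eq_zero.1 (hz v)
  rw [Multiset.count_map, Multiset.count_map]
  simp only [eq_comm (a := v)]
  exact_mod_cast hv.symm

lemma pos_of_mem_differingValues {d : ℕ} {x y : Fin d → ℝ} (hx : ∀ i, 0 < x i)
    (hy : ∀ i, 0 < y i) : ∀ v ∈ differingValues x y, 0 < v := by
  intro v hv
  have := (Finset.mem_filter.1 hv).1
  simp only [Finset.mem_union, Finset.mem_image, Finset.mem_univ, true_and] at this
  rcases this with ⟨i, rfl⟩ | ⟨i, rfl⟩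
  · exact hx i
  · exact hy i

/-- The difference of the hinge sums of `y ⊗ c` and `x ⊗ c` is a sum of translates of the
logarithmic hinge function. -/
lemma sum_hinge_vecTensor_sub {d : ℕ} {κ : Type*} [Fintype κ] (x y : Fin d → ℝ)
    (γ : κ → ℝ) (u : ℝ) :
    ∑ q, max (vecTensor y (fun j => Real.exp (γ j)) q - Real.exp u) 0 -
        ∑ q, max (vecTensor x (fun j => Real.exp (γ j)) q - Real.exp u) 0 =
      Real.exp u *
        ∑ j, logHinge (differingValues x y) (multiplicityDiff x y) (u - γ j) := by
  have e : ∀ (v : ℝ) (j : κ), max (v * Real.exp (γ j) - Real.exp u) 0 =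
      Real.exp u * max (v * Real.exp (-(u - γ j)) - 1) 0 := by
    intro v j
    have h : Real.exp u * Real.exp (-(u - γ j)) = Real.exp (γ j) := by
      rw [← Real.exp_add]
      ring_nf
    rw [mul_max_of_nonneg _ _ (Real.exp_pos u).le, mul_zero, mul_sub, mul_left_comm, h, mul_one]
  simp only [vecTensor, Fintype.sum_prod_type_right, e, ← Finset.mul_sum, ← mul_sub,
    ← Finset.sum_sub_distrib]
  congr 1
  refine Finset.sum_congr rfl fun j _ => ?_
  rw [Finset.sum_sub_distrib]
  exact sum_sub_sum_eq_sum_differingValues x y fun v => max (v * Real.exp (-(u - γ j)) - 1) 0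

/-- A catalyst is the same as a finite family of translates of the logarithmic hinge function with
nonnegative sum: the translations are the logarithms of the components of the catalyst. -/
theorem trumpedBy_iff_exists_sum_logHinge_nonneg {d : ℕ} {x y : Fin d → ℝ} (hx : ∀ i, 0 < x i)
    (hy : ∀ i, 0 < y i) :
    TrumpedBy x y ↔ ∑ i, x i = ∑ i, y i ∧
      ∃ n : ℕ, 1 ≤ n ∧ ∃ γ : Fin n → ℝ, ∀ u,
        0 ≤ ∑ j, logHinge (differingValues x y) (multiplicityDiff x y) (u - γ j) := by
  have hsum : ∀ {n : ℕ} (z : Fin d → ℝ) (c : Fin n → ℝ),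
      ∑ q, vecTensor z c q = (∑ i, z i) * ∑ j, c j := by
    intro n z c
    rw [Finset.sum_mul_sum, Fintype.sum_prod_type]
    rfl
  constructor
  · rintro ⟨n, hn, c, hc, hmaj⟩
    obtain ⟨heq, hle⟩ := (majorizedBy_iff_sum_hinge_le _ _).1 hmaj
    have hcs : 0 < ∑ j, c j := Finset.sum_pos (fun j _ => hc j) ⟨⟨0, hn⟩, Finset.mem_univ _⟩
    rw [hsum, hsum] at heq
    refine ⟨mul_right_cancel₀ hcs.ne' heq, n, hn, fun j => Real.log (c j), fun u => ?_⟩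
    have hcexp : c = fun j => Real.exp (Real.log (c j)) :=
      funext fun j => (Real.exp_log (hc j)).symm
    have hu := hle (Real.exp u)
    rw [hcexp, ← sub_nonneg, sum_hinge_vecTensor_sub] at hu
    exact nonneg_of_mul_nonneg_right hu (Real.exp_pos u)
  · rintro ⟨heq, n, hn, γ, hγ⟩
    refine ⟨n, hn, fun j => Real.exp (γ j), fun j => Real.exp_pos _, ?_⟩
    refine (majorizedBy_iff_sum_hinge_le _ _).2 ⟨by rw [hsum, hsum, heq], fun t => ?_⟩
    rcases le_or_gt t 0 with ht | ht
    · -- All components exceed a threshold `t ≤ 0`, so both sides are affine in `t`.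
      have hlow : ∀ z : Fin d → ℝ, (∀ i, 0 < z i) →
          ∑ q, max (vecTensor z (fun j => Real.exp (γ j)) q - t) 0 =
            (∑ i, z i) * ∑ j, Real.exp (γ j) - ∑ _q : Fin d × Fin n, t := by
        intro z hz
        rw [← hsum, ← Finset.sum_sub_distrib]
        refine Finset.sum_congr rfl fun q _ => max_eq_left ?_
        have : 0 < vecTensor z (fun j => Real.exp (γ j)) q := mul_pos (hz _) (Real.exp_pos _)
        linarith
      rw [hlow x hx, hlow y hy, heq]
    · rw [← Real.exp_log ht, ← sub_nonneg, sum_hinge_vecTensor_sub]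
      exact mul_nonneg (Real.exp_pos _).le (hγ _)

lemma pairZeta_eq_sum_differingValues {d : ℕ} (x y : Fin d → ℝ) (s : ℝ) :
    pairZeta x y s = ∑ v ∈ differingValues x y, multiplicityDiff x y v * (1 / v ^ s) :=
  sum_sub_sum_eq_sum_differingValues x y fun v => 1 / v ^ s

lemma isGeneralDirichletPolynomial_pairZeta {d : ℕ} {x y : Fin d → ℝ} (hx : ∀ i, 1 < x i)
    (hy : ∀ i, 1 < y i) : IsGeneralDirichletPolynomial (pairZeta x y) := by
  set S := differingValues x y with hS
  have h1 : ∀ v ∈ S, 1 < v := by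
    intro v hv
    have := (Finset.mem_filter.1 hv).1
    simp only [Finset.mem_union, Finset.mem_image, Finset.mem_univ, true_and] at this
    rcases this with ⟨i, rfl⟩ | ⟨i, rfl⟩
    · exact hx i
    · exact hy i
  have hmem : ∀ n, S.orderEmbOfFin rfl n ∈ S := fun n => S.orderEmbOfFin_mem rfl n
  refine ⟨S.card, fun n => multiplicityDiff x y (S.orderEmbOfFin rfl n),
    fun n => Real.log (S.orderEmbOfFin rfl n), fun m n hmn => ?_, fun n => ?_, fun s => ?_⟩
  · exact Real.log_lt_log (by linarith [h1 _ (hmem m)]) ((S.orderEmbOfFin rfl).strictMono hmn)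
  · exact Real.log_pos (h1 _ (hmem n))
  · rw [pairZeta_eq_sum_differingValues, ← Finset.sum_coe_sort,
      ← (S.orderIsoOfFin rfl).toEquiv.sum_comp]
    refine Finset.sum_congr rfl fun n _ => ?_
    have hpos : 0 < S.orderEmbOfFin rfl n := by linarith [h1 _ (hmem n)]
    change multiplicityDiff x y (S.orderEmbOfFin rfl n) * (1 / (S.orderEmbOfFin rfl n) ^ s) = _
    rw [Real.rpow_def_of_pos hpos, one_div, ← Real.exp_neg]
    ring_nf

/-- If `f s = s * (s + 1) * L s` with `L` continuous, then `f` has the derivative `(2 * a + 1) * L a`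
at a zero `a` of `s * (s + 1)`, so the zero is simple if `L a ≠ 0`. -/
lemma hasSimpleZeroAt_of_eq_mul {f L : ℝ → ℝ} (hL : Continuous L)
    (h : ∀ s, f s = s * (s + 1) * L s) {a : ℝ} (hf : AnalyticAt ℝ f a) (ha : a * (a + 1) = 0)
    (hLa : L a ≠ 0) : HasSimpleZeroAt f a := by
  have hfa : f a = 0 := by rw [h, ha, zero_mul]
  have hder : HasDerivAt f ((2 * a + 1) * L a) a := by
    rw [hasDerivAt_iff_tendsto_slope]
    have hc : Continuous fun s => (s + a + 1) * L s := by fun_prop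
    have hlim := (hc.tendsto a).mono_left (nhdsWithin_le_nhds (s := {a}ᶜ))
    have e : a + a + 1 = 2 * a + 1 := by ring
    rw [e] at hlim
    refine hlim.congr' ?_
    filter_upwards [self_mem_nhdsWithin] with s hs
    have hs : s - a ≠ 0 := sub_ne_zero.2 hs
    rw [slope_def_field, hfa, h, eq_div_iff hs]
    linear_combination (-L s) * ha
  refine hf.analyticOrderAt_eq_one_of_zero_deriv_ne_zero hfa ?_
  rw [hder.deriv]
  refine mul_ne_zero (fun h2 => ?_) hLa
  nlinarith

theorem mainTheorem4 (d : ℕ) (x y : Fin d → ℝ)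
    (hx : ∀ i, 1 < x i) (hy : ∀ i, 1 < y i)
    (hxy : decreasingRearrangement x ≠ decreasingRearrangement y) :
    TrumpedBy x y ↔
      (IsGeneralDirichletPolynomial (pairZeta x y) ∧
        HasSimpleZeroAt (pairZeta x y) (-1) ∧
        HasSimpleZeroAt (pairZeta x y) 0 ∧
        QuotientPositiveOnReals (pairZeta x y)) := by
  have hx0 : ∀ i, 0 < x i := fun i => one_pos.trans (hx i)
  have hy0 : ∀ i, 0 < y i := fun i => one_pos.trans (hy i)
  set S := differingValues x y with hSdef
  set w := multiplicityDiff x y with hw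
  have hS : ∀ v ∈ S, 0 < v := pos_of_mem_differingValues hx0 hy0
  have hne : S.Nonempty := differingValues_nonempty hxy
  have hwS : ∀ v ∈ S, w v ≠ 0 := fun v hv => (Finset.mem_filter.1 hv).2
  have h0 : ∑ v ∈ S, w v = 0 := by
    have := sum_sub_sum_eq_sum_differingValues x y fun _ => 1
    simpa using this.symm
  have h1 : ∑ i, x i = ∑ i, y i ↔ ∑ v ∈ S, w v * v = 0 := by
    rw [← sum_sub_sum_eq_sum_differingValues x y fun v => v, sub_eq_zero, eq_comm]
  set L : ℝ → ℝ := fun s => ∫ u in (Real.log (S.min' hne))..(Real.log (S.max' hne)),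
    logHinge S w u * Real.exp (-s * u) with hLdef
  have hLc : Continuous L := by
    refine intervalIntegral.continuous_parametric_intervalIntegral_of_continuous' ?_ _ _
    have := continuous_logHinge S w
    have : Continuous fun z : ℝ × ℝ => logHinge S w z.2 * Real.exp (-z.1 * z.2) := by fun_prop
    exact this
  have hζ : ∑ v ∈ S, w v * v = 0 → ∀ s, pairZeta x y s = s * (s + 1) * L s := by
    intro h1 s
    have := mul_integral_logHinge_mul_exp hS h0 h1
      (α := Real.log (S.min' hne)) (β := Real.log (S.max' hne))
      (fun v hv => Real.log_le_log (hS _ (S.min'_mem hne)) (S.min'_le v hv))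
      (fun v hv => Real.log_le_log (hS v hv) (S.le_max' v hv)) (-s)
    rw [show s * (s + 1) = -s * (-s - 1) by ring, hLdef, this, pairZeta_eq_sum_differingValues]
    refine Finset.sum_congr rfl fun v hv => ?_
    rw [Real.rpow_neg (hS v hv).le, one_div]
  rw [trumpedBy_iff_exists_sum_logHinge_nonneg hx0 hy0, h1]
  constructor
  · rintro ⟨h1, hn⟩
    have hpos := (exists_sum_logHinge_nonneg_iff hS hne hwS h0 h1).1 hn
    have hLpos : ∀ s, 0 < L s := fun s => hpos (-s)
    have hdir := isGeneralDirichletPolynomial_pairZeta hx hy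
    have han : ∀ a, AnalyticAt ℝ (pairZeta x y) a := by
      obtain ⟨k, c, l, -, -, h⟩ := hdir
      intro a
      rw [funext h]
      fun_prop
    refine ⟨hdir, hasSimpleZeroAt_of_eq_mul hLc (hζ h1) (han _) (by norm_num) (hLpos _).ne',
      hasSimpleZeroAt_of_eq_mul hLc (hζ h1) (han _) (by norm_num) (hLpos _).ne',
      L, hLc, fun s hs hs1 => ?_, hLpos⟩
    rw [hζ h1, mul_div_cancel_left₀]
    exact mul_ne_zero hs fun h => hs1 (by linarith)
  · rintro ⟨-, hm1, -, g, hgc, hg, hgpos⟩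
    have hz : pairZeta x y (-1) = 0 := by
      refine apply_eq_zero_of_analyticOrderAt_ne_zero (𝕜 := ℝ) ?_
      rw [hm1]
      exact one_ne_zero
    have h1' : ∑ v ∈ S, w v * v = 0 := by
      rw [pairZeta_eq_sum_differingValues] at hz
      simpa [Real.rpow_neg_one] using hz
    refine ⟨h1', (exists_sum_logHinge_nonneg_iff hS hne hwS h0 h1').2 fun p => ?_⟩
    -- The continuous functions `L` and `g` agree off the two removable singularities.
    have hLg : L = g := by
      have hdense : Dense (({0, -1} : Set ℝ)ᶜ) :=
        (Set.toFinite ({0, -1} : Set ℝ)).countable.dense_compl ℝ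
      refine hLc.ext_on hdense hgc fun s hs => ?_
      simp only [Set.mem_compl_iff, Set.mem_insert_iff, Set.mem_singleton_iff, not_or] at hs
      rw [hg s hs.1 hs.2, hζ h1', mul_div_cancel_left₀]
      exact mul_ne_zero hs.1 fun h => hs.2 (by linarith)
    have := hgpos (-p)
    rw [← hLg] at this
    simpa [hLdef] using this
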